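/- Let $1\le A_1<B_1\le\infty$ and let $\psi:(A_1,B_1)\to(0,\infty)$ be continuous with $\inf_{q\in(A_1,B_1)}\psi(q)>0$. Write $|g|_p=\left(\int_0^1|g(x)|^p\,dx\right)^{1/p}$. For a set $S$ of exponents and a weight $w:S\to(0,\infty)$, let $$\|g\|_{G(w;S)}=\sup_{p\in S}\frac{|g|_p}{w(p)} .$$ Write $\|g\|_{G(\psi)}$ for $\|g\|_{G(\psi;(A_1,B_1))}$, and write $g\in G(\psi)$ if this is finite. For $p,q\in(1,\infty)$ put $q^*=q/(q-1)$ and $$K(p,q)=\frac p2\,\frac{(1+q^*/p)^{1/q}}{(1+p/q^*)^{1/p}}\,\frac{\Gamma(1/p+1/q^*)}{\Gamma(1/p)\,\Gamma(1/q^*)},\qquad \nu(p)=\inf_{q\in(A_1,B_1)}K(p,q)\,\psi(q),$$ and write $\|g\|_{G(\nu)}$ for $\|g\|_{G(\nu;S)}$ with $S=\{p\in(1,\infty):\nu(p)<\infty\}$. **Theorem 7.1.** Let $f:[0,1]\to\mathbb R$ be absolutely continuous with $f(0)=f(1)=0$ and $f'\in G(\psi)$. Then $$\|f\|_{G(\nu)}\le\|f'\|_{G(\psi)}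 .$$ -/

import Mathlib

open MeasureTheory Set
open scoped ENNReal

noncomputable section

/-- The open interval `(A, B)` of finite exponents, where `B` may be `∞`. -/
def expInterval (A : ℝ) (B : EReal) : Set ℝ := {q | A < q ∧ (q : EReal) < B}

/-- The `L_p` norm `|f|_p` of `f` on `[0,1]` with Lebesgue measure (possibly infinite). -/
def unitLpNorm (f : ℝ → ℝ) (p : ℝ) : ℝ≥0∞ :=
  eLpNorm f (ENNReal.ofReal p) (volume.restrict (Icc 0 1))

/-- The Grand Lebesgue norm of `f` on `[0,1]` with weight `w` and exponents ranging over `S`: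
the supremum over `p ∈ S` of `|f|_p / w p` (possibly infinite). -/
def grandNorm (S : Set ℝ) (w : ℝ → ℝ≥0∞) (f : ℝ → ℝ) : ℝ≥0∞ :=
  ⨆ p ∈ S, unitLpNorm f p / w p

/-- The conjugate exponent `q / (q - 1)` of `q > 1`. -/
def conjExp (q : ℝ) : ℝ := q / (q - 1)

/-- The constant of the sharp inequality `|f|_p ≤ K(p,q) |f'|_q` on `[0,1]` for functions
vanishing at both end points, `1 < p, q < ∞`. -/
def wirtingerK (p q : ℝ) : ℝ :=
  p / 2 * ((1 + conjExp q / p) ^ (1 / q) / (1 + p / conjExp q) ^ (1 / p)) *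
    (Real.Gamma (1 / p + 1 / conjExp q) / (Real.Gamma (1 / p) * Real.Gamma (1 / conjExp q)))

/-- The weight `ν(p) = inf_{q ∈ (A,B)} K(p,q) ψ(q)`, as an extended nonnegative real. -/
def nuWeight (A : ℝ) (B : EReal) (ψ : ℝ → ℝ) (p : ℝ) : ℝ≥0∞ :=
  ⨅ q ∈ expInterval A B, ENNReal.ofReal (wirtingerK p q * ψ q)

/-- The exponents `p ∈ (1,∞)` at which `ν` is finite. -/
def nuSupport (A : ℝ) (B : EReal) (ψ : ℝ → ℝ) : Set ℝ :=
  {p | 1 < p ∧ nuWeight A B ψ p < ∞}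

end

/-! Everything reduces to the sharp bound |f|_p ≤ K(p,q) |f'|_q: since |f'|_q ≤ G ψ(q) with G the
norm of f', taking the infimum over q gives |f|_p ≤ G ν(p).

For the sharp bound, let M = max |f|, Y = ∫ |f|^p and w(u) = (M^p - |u|^p)₊^(1/q*). The function
goes from 0 to an extreme value ±M and back, so 2 ∫₀^M w ≤ ∫ w(f) |f'|
(`two_mul_integral_weight_le`). Hölder bounds the right side by |f'|_q (M^p - Y)^(1/q*), and the
left side is a Beta value times (M^p)^(1/p + 1/q*). Multiplying by Y^(1/p) and maximising Y^(1/p)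
(M^p - Y)^(1/q*) over Y (`rpow_mul_sub_rpow_le`) cancels M and leaves exactly K (`wirtingerK_eq`).
-/

/-! ### Weighted variation of absolutely continuous functions -/

/-- A `C¹` function of an absolutely continuous function is absolutely continuous. -/
theorem AbsolutelyContinuousOnInterval.contDiff_comp {f W : ℝ → ℝ} {a b : ℝ}
    (hf : AbsolutelyContinuousOnInterval f a b) (hW : ContDiff ℝ 1 W) :
    AbsolutelyContinuousOnInterval (W ∘ f) a b := by
  obtain ⟨C, hC⟩ := hf.exists_bound
  obtain ⟨K, hK⟩ := hW.contDiffOn.exists_lipschitzOnWith (s := Icc (-C) C) (by decide)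
    (convex_Icc _ _) isCompact_Icc
  have hmem : ∀ x ∈ uIcc a b, f x ∈ Icc (-C) C := fun x hx ↦ abs_le.1 (hC x hx)
  rw [absolutelyContinuousOnInterval_iff] at hf ⊢
  intro ε hε
  -- `K + 1` rather than `K`, since the Lipschitz constant may be 0.
  obtain ⟨δ, hδ, h⟩ := hf (ε / (K + 1)) (by positivity)
  refine ⟨δ, hδ, fun E hE hE' ↦ ?_⟩
  calc ∑ i ∈ Finset.range E.1, dist ((W ∘ f) (E.2 i).1) ((W ∘ f) (E.2 i).2)
      ≤ ∑ i ∈ Finset.range E.1, K * dist (f (E.2 i).1) (f (E.2 i).2) :=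
        Finset.sum_le_sum fun i hi ↦ hK.dist_le_mul (f _) (hmem _ (hE.1 i hi).1) (f _)
          (hmem _ (hE.1 i hi).2)
    _ = K * ∑ i ∈ Finset.range E.1, dist (f (E.2 i).1) (f (E.2 i).2) := by
        rw [Finset.mul_sum]
    _ ≤ (K + 1) * ∑ i ∈ Finset.range E.1, dist (f (E.2 i).1) (f (E.2 i).2) := by
        refine mul_le_mul_of_nonneg_right ?_ (Finset.sum_nonneg fun _ _ ↦ dist_nonneg)
        linarith
    _ < (K + 1) * (ε / (K + 1)) := by
        have := h E hE hE'
        gcongr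
    _ = ε := by field_simp

/-- For a primitive W of w, the composite W ∘ f is absolutely continuous with derivative w(f) f'
almost everywhere, so the fundamental theorem of calculus applies. -/
theorem AbsolutelyContinuousOnInterval.abs_integral_weight_le {f w : ℝ → ℝ} {a b : ℝ}
    (hab : a ≤ b) (hf : AbsolutelyContinuousOnInterval f a b) (hw : Continuous w)
    (hw0 : ∀ u, 0 ≤ w u) :
    |∫ u in f a..f b, w u| ≤ ∫ x in a..b, w (f x) * |deriv f x| := by
  set W : ℝ → ℝ := fun u ↦ ∫ s in (0 : ℝ)..u, w s with hWdef
  have hW' : ∀ u, HasDerivAt W (w u) u := fun u ↦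
    intervalIntegral.integral_hasDerivAt_right (hw.intervalIntegrable _ _)
      (hw.stronglyMeasurableAtFilter _ _) hw.continuousAt
  have hWd : deriv W = w := funext fun u ↦ (hW' u).deriv
  have hWC : ContDiff ℝ 1 W := by
    rw [contDiff_one_iff_deriv, hWd]
    exact ⟨fun u ↦ (hW' u).differentiableAt, hw⟩
  have hsub : ∫ u in f a..f b, w u = W (f b) - W (f a) :=
    (intervalIntegral.integral_interval_sub_left (hw.intervalIntegrable _ _)
      (hw.intervalIntegrable _ _)).symm
  have hFTC := (hf.contDiff_comp hWC).integral_deriv_eq_sub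
  have hcongr : ∫ x in a..b, deriv (W ∘ f) x = ∫ x in a..b, w (f x) * deriv f x := by
    apply intervalIntegral.integral_congr_ae
    filter_upwards [hf.ae_differentiableAt] with x hx hx'
    exact ((hW' (f x)).comp x (hx (uIoc_subset_uIcc hx')).hasDerivAt).deriv
  rw [hsub, ← Function.comp_apply (f := W), ← Function.comp_apply (f := W), ← hFTC, hcongr]
  refine (intervalIntegral.abs_integral_le_integral_abs hab).trans_eq ?_
  exact intervalIntegral.integral_congr fun x _ ↦ by simp [abs_mul, abs_of_nonneg (hw0 _)]

theorem AbsolutelyContinuousOnInterval.intervalIntegrable_weight_mul_abs_deriv {f w : ℝ → ℝ}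
    {a b : ℝ} (hf : AbsolutelyContinuousOnInterval f a b) (hw : Continuous w) :
    IntervalIntegrable (fun x ↦ w (f x) * |deriv f x|) volume a b :=
  hf.intervalIntegrable_deriv.abs.continuousOn_mul (hw.comp_continuousOn hf.continuousOn)

/-- A function vanishing at both end points goes up to its extreme value and back. -/
theorem AbsolutelyContinuousOnInterval.two_mul_integral_weight_le {f w : ℝ → ℝ} {a b m : ℝ}
    (hm : m ∈ Icc a b) (hf : AbsolutelyContinuousOnInterval f a b) (hfa : f a = 0) (hfb : f b = 0)
    (hw : Continuous w) (hw0 : ∀ u, 0 ≤ w u) (hw_even : ∀ u, w (-u) = w u) :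
    2 * ∫ u in (0 : ℝ)..|f m|, w u ≤ ∫ x in a..b, w (f x) * |deriv f x| := by
  have hab := hm.1.trans hm.2
  have hf₁ : AbsolutelyContinuousOnInterval f a m :=
    hf.mono (by rw [uIcc_of_le hm.1, uIcc_of_le hab]; exact Icc_subset_Icc_right hm.2)
  have hf₂ : AbsolutelyContinuousOnInterval f m b :=
    hf.mono (by rw [uIcc_of_le hm.2, uIcc_of_le hab]; exact Icc_subset_Icc_left hm.1)
  have h₁ := hf₁.abs_integral_weight_le hm.1 hw hw0
  have h₂ := hf₂.abs_integral_weight_le hm.2 hw hw0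
  rw [hfa] at h₁
  rw [hfb, intervalIntegral.integral_symm, abs_neg] at h₂
  have habs : ∫ u in (0 : ℝ)..|f m|, w u ≤ |∫ u in (0 : ℝ)..f m, w u| := by
    rcases abs_cases (f m) with ⟨h, -⟩ | ⟨h, -⟩
    · rw [h]; exact le_abs_self _
    · have := intervalIntegral.integral_comp_neg (a := 0) (b := f m) w
      simp only [hw_even, neg_zero] at this
      rw [h, this, intervalIntegral.integral_symm]
      exact neg_le_abs _
  rw [← intervalIntegral.integral_add_adjacent_intervals
    (hf₁.intervalIntegrable_weight_mul_abs_deriv hw)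
    (hf₂.intervalIntegrable_weight_mul_abs_deriv hw)]
  linarith

/-! ### Beta integrals and the constant K -/

/-- The substitution s = x^(1/p) gives a Beta integral, whose value is read off from the total mass
of the Beta density. -/
theorem integral_one_sub_rpow_rpow {p b : ℝ} (hp : 0 < p) (hb : 0 < b) :
    ∫ s in (0 : ℝ)..1, (1 - s ^ p) ^ b = p⁻¹ * ProbabilityTheory.beta p⁻¹ (b + 1) := by
  have hbeta : ∫ x in Ioo (0 : ℝ) 1, x ^ (p⁻¹ - 1) * (1 - x) ^ b
      = ProbabilityTheory.beta p⁻¹ (b + 1) := by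
    have hp' : 0 < p⁻¹ := inv_pos.2 hp
    have hb' : 0 < b + 1 := by linarith
    have hpos := ProbabilityTheory.beta_pos hp' hb'
    have h := ProbabilityTheory.lintegral_betaPDF_eq_one hp' hb'
    rw [ProbabilityTheory.lintegral_betaPDF] at h
    have h1 : ∫ x in Ioo (0 : ℝ) 1,
        1 / ProbabilityTheory.beta p⁻¹ (b + 1) * x ^ (p⁻¹ - 1) * (1 - x) ^ (b + 1 - 1) = 1 := by
      rw [integral_eq_lintegral_of_nonneg_ae, h, ENNReal.toReal_one]
      · filter_upwards [ae_restrict_mem measurableSet_Ioo] with x hx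
        have h0 := hx.1.le
        have h1 : 0 ≤ 1 - x := by linarith [hx.2]
        simp only [Pi.zero_apply]
        positivity
      · exact Measurable.aestronglyMeasurable (by fun_prop)
    simp only [add_sub_cancel_right, mul_assoc, integral_const_mul] at h1
    rwa [one_div, inv_mul_eq_one₀ hpos.ne', eq_comm] at h1
  -- The change of variables lives on (0, ∞); the indicator restricts it to (0, 1).
  have hsub := integral_comp_rpow_Ioi_of_pos
    (g := (Ioo (0 : ℝ) 1).indicator fun y ↦ (1 - y ^ p) ^ b) (inv_pos.2 hp)
  rw [intervalIntegral.integral_of_le zero_le_one, integral_Ioc_eq_integral_Ioo]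
  rw [setIntegral_indicator measurableSet_Ioo,
    inter_eq_self_of_subset_right Ioo_subset_Ioi_self] at hsub
  rw [← hsub, ← hbeta, ← integral_const_mul, ← integral_indicator measurableSet_Ioo,
    ← integral_indicator measurableSet_Ioi]
  congr 1 with x
  by_cases hx0 : 0 < x
  · rw [indicator_of_mem (mem_Ioi.2 hx0)]
    by_cases hx1 : x < 1
    · have hmem : x ^ p⁻¹ ∈ Ioo (0 : ℝ) 1 :=
        ⟨by positivity, Real.rpow_lt_one hx0.le hx1 (inv_pos.2 hp)⟩
      rw [indicator_of_mem (show x ∈ Ioo (0 : ℝ) 1 from ⟨hx0, hx1⟩), indicator_of_mem hmem,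
        Real.rpow_inv_rpow hx0.le hp.ne', smul_eq_mul, mul_assoc]
    · have hmem : x ^ p⁻¹ ∉ Ioo (0 : ℝ) 1 := fun h ↦
        h.2.not_ge (Real.one_le_rpow (not_lt.1 hx1) (inv_nonneg.2 hp.le))
      rw [indicator_of_notMem (fun h : x ∈ Ioo (0 : ℝ) 1 ↦ hx1 h.2), indicator_of_notMem hmem,
        smul_zero]
  · rw [indicator_of_notMem (by simpa using hx0), indicator_of_notMem (fun h ↦ hx0 h.1)]

/-- The weight is `(M ^ p - |u| ^ p)₊ ^ b`. -/
theorem integral_rpow_sub_rpow_rpow {p b M : ℝ} (hp : 0 < p) (hb : 0 < b) (hM : 0 < M) :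
    ∫ u in (0 : ℝ)..M, (max (M ^ p - |u| ^ p) 0) ^ b =
      (M ^ p) ^ (p⁻¹ + b) * (p⁻¹ * ProbabilityTheory.beta p⁻¹ (b + 1)) := by
  rw [← integral_one_sub_rpow_rpow hp hb]
  have h := intervalIntegral.mul_integral_comp_mul_left (a := 0) (b := 1)
    (f := fun u : ℝ ↦ (max (M ^ p - |u| ^ p) 0) ^ b) M
  rw [mul_zero, mul_one] at h
  rw [← h, Real.rpow_add (by positivity), Real.rpow_rpow_inv hM.le hp.ne', mul_assoc,
    ← intervalIntegral.integral_const_mul ((M ^ p) ^ b)]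
  refine congrArg (M * ·) (intervalIntegral.integral_congr fun s hs ↦ ?_)
  rw [uIcc_of_le zero_le_one] at hs
  have h1 : s ^ p ≤ 1 := Real.rpow_le_one hs.1 hs.2 hp.le
  have h2 : M ^ p - |M * s| ^ p = M ^ p * (1 - s ^ p) := by
    rw [abs_of_nonneg (mul_nonneg hM.le hs.1), Real.mul_rpow hM.le hs.1]; ring
  have h3 : 0 ≤ M ^ p * (1 - s ^ p) := mul_nonneg (by positivity) (by linarith)
  rw [h2, max_eq_left h3, Real.mul_rpow (by positivity) (by linarith)]

/-- Weighted AM-GM with weights a/(a+b) and b/(a+b), raised to the power a + b. Equality holds at y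
= a t/(a+b), so no sharpness is lost. -/
theorem rpow_mul_sub_rpow_le {a b t y : ℝ} (ha : 0 < a) (hb : 0 < b) (hy : 0 ≤ y) (hyt : y ≤ t) :
    y ^ a * (t - y) ^ b ≤ (a / (a + b)) ^ a * (b / (a + b)) ^ b * t ^ (a + b) := by
  have hab : 0 < a + b := by positivity
  have hty : 0 ≤ t - y := by linarith
  have h := Real.geom_mean_le_arith_mean2_weighted (w₁ := a / (a + b)) (w₂ := b / (a + b))
    (p₁ := y / (a / (a + b))) (p₂ := (t - y) / (b / (a + b))) (by positivity) (by positivity)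
    (by positivity) (by positivity) (by field_simp)
  have hr : a / (a + b) * (y / (a / (a + b))) + b / (a + b) * ((t - y) / (b / (a + b))) = t := by
    field_simp; ring
  rw [hr] at h
  have h2 := Real.rpow_le_rpow (by positivity) h hab.le
  rw [Real.mul_rpow (by positivity) (by positivity), ← Real.rpow_mul (by positivity),
    ← Real.rpow_mul (by positivity), div_mul_cancel₀ _ hab.ne', div_mul_cancel₀ _ hab.ne',
    Real.div_rpow hy (by positivity), Real.div_rpow hty (by positivity)] at h2
  calc y ^ a * (t - y) ^ b = (a / (a + b)) ^ a * (b / (a + b)) ^ b *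
        (y ^ a / (a / (a + b)) ^ a * ((t - y) ^ b / (b / (a + b)) ^ b)) := by
        field_simp
    _ ≤ _ := by gcongr

/-- With a = 1/p and b = 1/q*, one has 1/q = 1 - b, and the Gamma recurrence clears the shift by 1
in the Beta value. -/
theorem wirtingerK_eq {p q : ℝ} (hp : 1 < p) (hq : 1 < q) :
    wirtingerK p q * (2 * (p⁻¹ * ProbabilityTheory.beta p⁻¹ ((conjExp q)⁻¹ + 1))) =
      (p⁻¹ / (p⁻¹ + (conjExp q)⁻¹)) ^ p⁻¹ *
        ((conjExp q)⁻¹ / (p⁻¹ + (conjExp q)⁻¹)) ^ (conjExp q)⁻¹ := by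
  have hp0 : 0 < p := by linarith
  obtain ⟨a, ha, rfl⟩ : ∃ a : ℝ, 0 < a ∧ p = a⁻¹ := ⟨p⁻¹, by positivity, by simp⟩
  have hqc : 1 / q = 1 - (conjExp q)⁻¹ := by
    rw [conjExp]; have : q - 1 ≠ 0 := by linarith
    field_simp; ring
  obtain ⟨b, hb, hbq⟩ : ∃ b : ℝ, 0 < b ∧ conjExp q = b⁻¹ :=
    ⟨(conjExp q)⁻¹, inv_pos.2 (div_pos (by linarith) (by linarith)), by simp⟩
  rw [wirtingerK, hqc, hbq, ProbabilityTheory.beta, ← add_assoc]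
  simp only [inv_inv, one_div]
  have hab : 0 < a + b := by positivity
  rw [Real.Gamma_add_one hb.ne', Real.Gamma_add_one hab.ne']
  have e1 : 1 + b⁻¹ / a⁻¹ = (b / (a + b))⁻¹ := by field_simp; ring
  have e2 : 1 + a⁻¹ / b⁻¹ = (a / (a + b))⁻¹ := by field_simp
  have e3 : ((b / (a + b))⁻¹) ^ (1 - b) = (b / (a + b))⁻¹ * (b / (a + b)) ^ b := by
    rw [Real.rpow_sub (by positivity), Real.rpow_one, Real.inv_rpow (by positivity), div_inv_eq_mul]
  rw [e1, e2, e3, Real.inv_rpow (by positivity)]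
  have g1 := Real.Gamma_pos_of_pos ha
  have g2 := Real.Gamma_pos_of_pos hb
  have g3 := Real.Gamma_pos_of_pos hab
  generalize (b / (a + b)) ^ b = u
  generalize (a / (a + b)) ^ a = v
  field_simp

theorem wirtingerK_pos {p q : ℝ} (hp : 1 < p) (hq : 1 < q) : 0 < wirtingerK p q := by
  have hq' : 0 < conjExp q := div_pos (by linarith) (by linarith)
  have hp0 : 0 < p := by linarith
  have g1 := Real.Gamma_pos_of_pos (show 0 < 1 / p by positivity)
  have g2 := Real.Gamma_pos_of_pos (show 0 < 1 / conjExp q by positivity)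
  have g3 := Real.Gamma_pos_of_pos (show 0 < 1 / p + 1 / conjExp q by positivity)
  unfold wirtingerK
  positivity

/-! ### The sharp inequality on [0,1] -/

theorem unitLpNorm_eq_lintegral (f : ℝ → ℝ) {p : ℝ} (hp : 0 < p) :
    unitLpNorm f p = (∫⁻ x in Icc 0 1, ‖f x‖ₑ ^ p) ^ (1 / p) := by
  rw [unitLpNorm, eLpNorm_eq_lintegral_rpow_enorm_toReal (by simpa) ENNReal.ofReal_ne_top,
    ENNReal.toReal_ofReal hp.le]

theorem unitLpNorm_eq_ofReal_integral {f : ℝ → ℝ} (hf : ContinuousOn f (Icc 0 1)) {p : ℝ}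
    (hp : 0 < p) :
    unitLpNorm f p = ENNReal.ofReal ((∫ x in Icc (0 : ℝ) 1, |f x| ^ p) ^ p⁻¹) := by
  have hint : IntegrableOn (fun x ↦ |f x| ^ p) (Icc 0 1) :=
    (hf.abs.rpow_const fun _ _ ↦ Or.inr hp.le).integrableOn_Icc
  rw [unitLpNorm_eq_lintegral f hp, one_div, ← ENNReal.ofReal_rpow_of_nonneg
    (integral_nonneg fun x ↦ by positivity) (by positivity),
    ofReal_integral_eq_lintegral_ofReal hint (ae_of_all _ fun x ↦ by positivity)]
  congr 1
  refine lintegral_congr fun x ↦ ?_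
  rw [← ENNReal.ofReal_rpow_of_nonneg (abs_nonneg _) hp.le, Real.enorm_eq_ofReal_abs]

/-- Hölder's inequality for the weight `(M ^ p - |f| ^ p) ^ (1 / q*)` against `f'`. -/
theorem integral_weight_mul_abs_deriv_le {f : ℝ → ℝ} {p q M : ℝ} (hp : 0 < p) (hq : 1 < q)
    (hf : AbsolutelyContinuousOnInterval f 0 1) (hM : ∀ x ∈ Icc (0 : ℝ) 1, |f x| ≤ M)
    (hf' : unitLpNorm (deriv f) q ≠ ∞) :
    ∫ x in (0 : ℝ)..1, (max (M ^ p - |f x| ^ p) 0) ^ (conjExp q)⁻¹ * |deriv f x| ≤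
      (unitLpNorm (deriv f) q).toReal *
        (M ^ p - ∫ x in Icc (0 : ℝ) 1, |f x| ^ p) ^ (conjExp q)⁻¹ := by
  have hfc : ContinuousOn f (Icc 0 1) := by simpa using hf.continuousOn
  have hpq : q.HolderConjugate (conjExp q) := Real.HolderConjugate.conjExponent hq
  have hq' := hpq.symm.pos
  have hw : Continuous fun u : ℝ ↦ (max (M ^ p - |u| ^ p) 0) ^ (conjExp q)⁻¹ := by
    refine Continuous.rpow_const ?_ fun _ ↦ Or.inr (by positivity)
    exact (continuous_const.sub (continuous_abs.rpow_const fun _ ↦ Or.inr hp.le)).max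
      continuous_const
  have hle : ∀ x ∈ Icc (0 : ℝ) 1, 0 ≤ M ^ p - |f x| ^ p := fun x hx ↦
    sub_nonneg.2 (Real.rpow_le_rpow (abs_nonneg _) (hM x hx) hp.le)
  have hint : IntegrableOn (fun x ↦ |f x| ^ p) (Icc 0 1) :=
    (hfc.abs.rpow_const fun _ _ ↦ Or.inr hp.le).integrableOn_Icc
  have hsub : ∫ x in Icc (0 : ℝ) 1, (M ^ p - |f x| ^ p) =
      M ^ p - ∫ x in Icc (0 : ℝ) 1, |f x| ^ p := by
    rw [integral_sub (by simp) hint]; simp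
  have hnn : 0 ≤ M ^ p - ∫ x in Icc (0 : ℝ) 1, |f x| ^ p := by
    rw [← hsub]; exact setIntegral_nonneg measurableSet_Icc hle
  have hintw := hf.intervalIntegrable_weight_mul_abs_deriv hw
  rw [intervalIntegrable_iff_integrableOn_Icc_of_le zero_le_one] at hintw
  rw [intervalIntegral.integral_of_le zero_le_one, ← integral_Icc_eq_integral_Ioc,
    ← ENNReal.ofReal_le_ofReal_iff (by positivity),
    ofReal_integral_eq_lintegral_ofReal hintw (ae_of_all _ fun x ↦ by positivity),
    ENNReal.ofReal_mul ENNReal.toReal_nonneg, ENNReal.ofReal_toReal hf']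
  have hHolder := ENNReal.lintegral_mul_le_Lp_mul_Lq (volume.restrict (Icc (0 : ℝ) 1)) hpq
    (f := fun x ↦ ‖deriv f x‖ₑ)
    (g := fun x ↦ ENNReal.ofReal ((max (M ^ p - |f x| ^ p) 0) ^ (conjExp q)⁻¹))
    (measurable_deriv f).enorm.aemeasurable
    (((hw.comp_continuousOn hfc).aemeasurable measurableSet_Icc).ennreal_ofReal)
  -- The power q* undoes the exponent 1/q*, and the truncation is inactive because |f| ≤ M.
  have hR : ∫⁻ x in Icc (0 : ℝ) 1,
      ENNReal.ofReal ((max (M ^ p - |f x| ^ p) 0) ^ (conjExp q)⁻¹) ^ conjExp q =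
        ENNReal.ofReal (M ^ p - ∫ x in Icc (0 : ℝ) 1, |f x| ^ p) := by
    rw [← hsub, ofReal_integral_eq_lintegral_ofReal
      (f := fun x ↦ M ^ p - |f x| ^ p) (Integrable.sub (by simp) hint)
      ((ae_restrict_iff' measurableSet_Icc).2 (ae_of_all _ hle))]
    refine setLIntegral_congr_fun measurableSet_Icc fun x hx ↦ ?_
    rw [max_eq_left (hle x hx), ENNReal.ofReal_rpow_of_nonneg
      (Real.rpow_nonneg (hle x hx) _) hq'.le, Real.rpow_inv_rpow (hle x hx) hq'.ne']
  rw [hR, ← unitLpNorm_eq_lintegral _ hpq.pos, one_div,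
    ENNReal.ofReal_rpow_of_nonneg hnn (by positivity)] at hHolder
  refine le_trans (le_of_eq (lintegral_congr fun x ↦ ?_)) hHolder
  rw [ENNReal.ofReal_mul (by positivity), mul_comm, Pi.mul_apply, Real.enorm_eq_ofReal_abs]

/-- The sharp inequality `|f|_p ≤ K(p,q) |f'|_q` for functions vanishing at both end points. -/
theorem unitLpNorm_le_wirtingerK_mul {f : ℝ → ℝ} {p q : ℝ} (hp : 1 < p) (hq : 1 < q)
    (hf : AbsolutelyContinuousOnInterval f 0 1) (hf0 : f 0 = 0) (hf1 : f 1 = 0) :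
    unitLpNorm f p ≤ ENNReal.ofReal (wirtingerK p q) * unitLpNorm (deriv f) q := by
  have hp0 : 0 < p := by linarith
  have hK := wirtingerK_pos hp hq
  by_cases hf' : unitLpNorm (deriv f) q = ∞
  · rw [hf', ENNReal.mul_top (by simpa using hK)]
    exact le_top
  have hfc : ContinuousOn f (Icc 0 1) := by simpa using hf.continuousOn
  have hq' : 0 < (conjExp q)⁻¹ := inv_pos.2 (div_pos (by linarith) (by linarith))
  obtain ⟨m, hm, hmax⟩ := isCompact_Icc.exists_isMaxOn (nonempty_Icc.2 zero_le_one) hfc.abs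
  have hM : ∀ x ∈ Icc (0 : ℝ) 1, |f x| ≤ |f m| := fun x hx ↦ hmax hx
  rw [unitLpNorm_eq_ofReal_integral hfc hp0, ← ENNReal.ofReal_toReal hf',
    ← ENNReal.ofReal_mul hK.le]
  refine ENNReal.ofReal_le_ofReal ?_
  have hY0 : 0 ≤ ∫ x in Icc (0 : ℝ) 1, |f x| ^ p := integral_nonneg fun x ↦ by positivity
  have hYM : ∫ x in Icc (0 : ℝ) 1, |f x| ^ p ≤ |f m| ^ p := by
    calc ∫ x in Icc (0 : ℝ) 1, |f x| ^ p ≤ ∫ _ in Icc (0 : ℝ) 1, |f m| ^ p :=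
          setIntegral_mono_on (hfc.abs.rpow_const fun _ _ ↦ Or.inr hp0.le).integrableOn_Icc
            (by simp) measurableSet_Icc
            fun x hx ↦ Real.rpow_le_rpow (abs_nonneg _) (hM x hx) hp0.le
      _ = |f m| ^ p := by simp
  have hX0 : 0 ≤ (unitLpNorm (deriv f) q).toReal := ENNReal.toReal_nonneg
  -- If M = 0 the power of M to be cancelled vanishes, but then so does |f|_p.
  rcases (abs_nonneg (f m)).eq_or_lt with hm0 | hmpos
  · rw [← hm0, Real.zero_rpow hp0.ne'] at hYM
    rw [le_antisymm hYM hY0, Real.zero_rpow (inv_ne_zero hp0.ne')]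
    positivity
  have hw : Continuous fun u : ℝ ↦ (max (|f m| ^ p - |u| ^ p) 0) ^ (conjExp q)⁻¹ := by
    refine Continuous.rpow_const ?_ fun _ ↦ Or.inr (by positivity)
    exact (continuous_const.sub (continuous_abs.rpow_const fun _ ↦ Or.inr hp0.le)).max
      continuous_const
  have h := (hf.two_mul_integral_weight_le hm hf0 hf1 hw (fun _ ↦ by positivity)
    (fun _ ↦ by simp)).trans (integral_weight_mul_abs_deriv_le hp0 hq hf hM hf')
  rw [integral_rpow_sub_rpow_rpow hp0 hq' hmpos] at h
  have hAG := rpow_mul_sub_rpow_le (inv_pos.2 hp0) hq' hY0 hYM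
  rw [← wirtingerK_eq hp hq] at hAG
  have hβ := ProbabilityTheory.beta_pos (inv_pos.2 hp0) (show 0 < (conjExp q)⁻¹ + 1 by linarith)
  have hT : 0 < (|f m| ^ p) ^ (p⁻¹ + (conjExp q)⁻¹) := by positivity
  generalize ProbabilityTheory.beta p⁻¹ ((conjExp q)⁻¹ + 1) = β at *
  generalize (|f m| ^ p) ^ (p⁻¹ + (conjExp q)⁻¹) = T at *
  have hYa : 0 ≤ (∫ x in Icc (0 : ℝ) 1, |f x| ^ p) ^ p⁻¹ := by positivity
  generalize (∫ x in Icc (0 : ℝ) 1, |f x| ^ p) ^ p⁻¹ = y at *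
  generalize (|f m| ^ p - ∫ x in Icc (0 : ℝ) 1, |f x| ^ p) ^ (conjExp q)⁻¹ = z at *
  generalize (unitLpNorm (deriv f) q).toReal = X at *
  have hc : 0 < 2 * (T * (p⁻¹ * β)) := by positivity
  refine le_of_mul_le_mul_right ?_ hc
  calc y * (2 * (T * (p⁻¹ * β))) ≤ y * (X * z) := by gcongr
    _ = X * (y * z) := by ring
    _ ≤ X * (wirtingerK p q * (2 * (p⁻¹ * β)) * T) := by gcongr
    _ = _ := by ring

/-! ### Passage to the Grand Lebesgue norms -/

theorem theorem7p1 (A₁ : ℝ) (B₁ : EReal) (hA : 1 ≤ A₁) (hAB : (A₁ : EReal) < B₁)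
    (ψ : ℝ → ℝ) (hψ_cont : ContinuousOn ψ (expInterval A₁ B₁))
    (hψ_pos : ∃ c : ℝ, 0 < c ∧ ∀ q ∈ expInterval A₁ B₁, c ≤ ψ q)
    (f : ℝ → ℝ) (hf : AbsolutelyContinuousOnInterval f 0 1)
    (hf0 : f 0 = 0) (hf1 : f 1 = 0)
    (hf' : grandNorm (expInterval A₁ B₁) (fun q => ENNReal.ofReal (ψ q)) (deriv f) < ∞) :
    grandNorm (nuSupport A₁ B₁ ψ) (nuWeight A₁ B₁ ψ) f ≤
      grandNorm (expInterval A₁ B₁) (fun q => ENNReal.ofReal (ψ q)) (deriv f) := by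
  obtain ⟨c, hc, hcψ⟩ := hψ_pos
  set G := grandNorm (expInterval A₁ B₁) (fun q => ENNReal.ofReal (ψ q)) (deriv f) with hG
  refine iSup₂_le fun p hp ↦ ENNReal.div_le_of_le_mul ?_
  have key : ∀ q ∈ expInterval A₁ B₁,
      unitLpNorm f p ≤ G * ENNReal.ofReal (wirtingerK p q * ψ q) := by
    intro q hq
    have hq1 : 1 < q := hA.trans_lt hq.1
    have hψq : 0 < ψ q := hc.trans_le (hcψ q hq)
    have hle : unitLpNorm (deriv f) q ≤ G * ENNReal.ofReal (ψ q) := by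
      rw [← ENNReal.div_le_iff (by simpa using hψq) ENNReal.ofReal_ne_top]
      exact le_iSup₂ (f := fun q (_ : q ∈ expInterval A₁ B₁) ↦
        unitLpNorm (deriv f) q / ENNReal.ofReal (ψ q)) q hq
    calc unitLpNorm f p ≤ ENNReal.ofReal (wirtingerK p q) * unitLpNorm (deriv f) q :=
          unitLpNorm_le_wirtingerK_mul hp.1 hq1 hf hf0 hf1
      _ ≤ ENNReal.ofReal (wirtingerK p q) * (G * ENNReal.ofReal (ψ q)) := by gcongr
      _ = G * ENNReal.ofReal (wirtingerK p q * ψ q) := by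
          rw [ENNReal.ofReal_mul (wirtingerK_pos hp.1 hq1).le]; ring
  -- Moving the infimum past G divides by G; when G = 0, a single exponent q already forces |f|_p =
  -- 0.
  rcases eq_or_ne G 0 with hG0 | hG0
  · obtain ⟨q, hAq, hqB⟩ := EReal.lt_iff_exists_real_btwn.1 hAB
    simpa [hG0] using key q ⟨by exact_mod_cast hAq, hqB⟩
  · rw [← ENNReal.div_le_iff' hG0 hf'.ne]
    exact le_iInf₂ fun q hq ↦ (ENNReal.div_le_iff' hG0 hf'.ne).2 (key q hq)
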